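/- A GLP-algebra is a Boolean algebra $\mathcal M$ with unary operations $\langle n\rangle$ ($n<\omega$) such that, writing $[n]x=\neg\langle n\rangle\neg x$, for all $x,y\in\mathcal M$: $\langle n\rangle(x\vee y)=\langle n\rangle x\vee\langle n\rangle y$; $\langle n\rangle 0=0$; $\langle n\rangle x=\langle n\rangle(x\wedge\neg\langle n\rangle x)$; $\langle n\rangle x\le\langle m\rangle x$ for $m\le n$; and $\langle m\rangle x\le[n]\langle m\rangle x$ for $m<n$. Put $Q_n^0(x)=\top$ and $Q_n^{k+1}(x)=\langle n\rangle(x\wedge Q_n^k(x))$. For $A\subseteq\mathcal M$ write $A\vdash x$ if $x$ lies in the filter generated by $A$. The algebra $\mathcal M$ has the $\langle n\rangle$-reduction property if for all $x,z\in\mathcal M$: $\langle n+1\rangle x\vdash\langle n\rangle z$ implies $\{Q_n^k(x):k<\omega\}\vdash\langle n\rangle z$. The logic $\mathbf{GLP}$, in the language with modalities $[n]$, $n<\omega$, and $\langle n\rangle\varphi=\neg[n]\neg\varphi$, has as axioms all propositional tautologies, $[n](\varphi\to\psi)\to([n]\varphi\to[n]\psi)$, $[n]([n]\varphi\to\varphi)\to[n]\varphi$,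 $[m]\varphi\to[n]\varphi$ for $m\le n$, and $\langle m\rangle\varphi\to[n]\langle m\rangle\varphi$ for $m<n$; its rules are modus ponens and $\varphi/[n]\varphi$. The formulas $Q_n^k(\varphi)$ are defined as above. Theorem. (1) For every set of variables, the Lindenbaum algebra of $\mathbf{GLP}$ (formulas modulo provable equivalence) is the free GLP-algebra generated by the classes of the variables. This algebra, and hence every free GLP-algebra on any set of generators, has the $\langle n\rangle$-reduction property for all $n$. (2) If $\mathbf{GLP}\vdash\langle m+1\rangle\psi\to\langle m\rangle\varphi$, then there is a $k$ such that $\mathbf{GLP}\vdash Q_m^k(\psi)\to\langle m\rangle\varphi$. Moreover, $k$ can be chosen depending only on the maximum of the modal depths of $\varphi$ and $\psi$, on the number of variables occurring in $\varphi$ or $\psi$, and on the number of modalities $[i]$ occurring in $\varphi$ or $\psi$. -/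

import Mathlib

universe u v w

namespace GLP

/-! ### GLP-algebras -/

/-- A GLP-algebra: a Boolean algebra with operations `dia n = ⟨n⟩`, `n < ω`. -/
class GLPAlgebra (M : Type u) extends BooleanAlgebra M where
  dia : ℕ → M → M
  dia_sup : ∀ (n : ℕ) (x y : M), dia n (x ⊔ y) = dia n x ⊔ dia n y
  dia_bot : ∀ n : ℕ, dia n ⊥ = ⊥
  dia_loeb : ∀ (n : ℕ) (x : M), dia n x = dia n (x ⊓ (dia n x)ᶜ)
  dia_anti : ∀ (m n : ℕ) (x : M), m ≤ n → dia n x ≤ dia m x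
  dia_le_box_dia : ∀ (m n : ℕ) (x : M), m < n → dia m x ≤ (dia n (dia m x)ᶜ)ᶜ

/-- Homomorphisms of GLP-algebras (a bounded lattice homomorphism between Boolean algebras also
preserves complements). -/
structure GLPHom (M : Type u) (N : Type v) [GLPAlgebra M] [GLPAlgebra N]
    extends BoundedLatticeHom M N where
  map_dia : ∀ (n : ℕ) (x : M), toFun (GLPAlgebra.dia n x) = GLPAlgebra.dia n (toFun x)

/-- `M` is the free GLP-algebra with free generators `g a`, `a : α` (universal property with
respect to the GLP-algebras in the universe `w`). -/
def IsFreeOn {α : Type u} {M : Type v} [GLPAlgebra M] (g : α → M) : Prop :=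
  ∀ (N : Type w) [GLPAlgebra N] (f : α → N),
    ∃! h : GLPHom M N, ∀ a, h.toFun (g a) = f a

/-- `A ⊢ x`: the element `x` lies in the filter generated by `A`. -/
def Entails {M : Type u} [GLPAlgebra M] (A : Set M) (x : M) : Prop :=
  ∃ F : Finset M, (F : Set M) ⊆ A ∧ F.inf id ≤ x

/-- The `⟨n⟩`-conservativity relation `A ⊢ₙ B`. -/
def Conserv {M : Type u} [GLPAlgebra M] (n : ℕ) (A B : Set M) : Prop :=
  ∀ z : M, Entails B (GLPAlgebra.dia n z) → Entails A (GLPAlgebra.dia n z)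

/-- `Q_n^0(x) = ⊤`, `Q_n^{k+1}(x) = ⟨n⟩(x ∧ Q_n^k(x))` in a GLP-algebra. -/
def algQ {M : Type u} [GLPAlgebra M] (n : ℕ) (x : M) : ℕ → M
  | 0 => ⊤
  | k + 1 => GLPAlgebra.dia n (x ⊓ algQ n x k)

/-- The `⟨n⟩`-reduction property. -/
def ReductionProperty (M : Type u) [GLPAlgebra M] (n : ℕ) : Prop :=
  ∀ x : M, Conserv n (Set.range (algQ n x)) {GLPAlgebra.dia (n + 1) x}

/-! ### The logic GLP -/

/-- Polymodal formulas with variables in `α` and modalities `[n]`, `n < ω`. -/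
inductive Formula (α : Type u) : Type u
  | var : α → Formula α
  | bot : Formula α
  | imp : Formula α → Formula α → Formula α
  | box : ℕ → Formula α → Formula α

namespace Formula

variable {α : Type u}

def neg (φ : Formula α) : Formula α := imp φ bot

def top : Formula α := neg bot

def and (φ ψ : Formula α) : Formula α := neg (imp φ (neg ψ))

def or (φ ψ : Formula α) : Formula α := imp (neg φ) ψ

/-- `⟨n⟩φ = ¬[n]¬φ`. -/
def dia (n : ℕ) (φ : Formula α) : Formula α := neg (box n (neg φ))

/-- Modal depth. -/
def depth : Formula α → ℕ
  | var _ => 0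
  | bot => 0
  | imp φ ψ => max φ.depth ψ.depth
  | box _ φ => φ.depth + 1

/-- The (finite) set of variables occurring in a formula. -/
def vars : Formula α → Set α
  | var a => {a}
  | bot => ∅
  | imp φ ψ => φ.vars ∪ ψ.vars
  | box _ φ => φ.vars

/-- The (finite) set of indices `n` of the modalities `[n]` occurring in a formula. -/
def mods : Formula α → Set ℕ
  | var _ => ∅
  | bot => ∅
  | imp φ ψ => φ.mods ∪ ψ.mods
  | box n φ => insert n φ.mods

theorem vars_finite (φ : Formula α) : φ.vars.Finite := by
  induction φ with
  | var a => exact Set.finite_singleton a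
  | bot => exact Set.finite_empty
  | imp φ ψ h1 h2 => exact h1.union h2
  | box n φ h => exact h

theorem mods_finite (φ : Formula α) : φ.mods.Finite := by
  induction φ with
  | var a => exact Set.finite_empty
  | bot => exact Set.finite_empty
  | imp φ ψ h1 h2 => exact h1.union h2
  | box n φ h => exact h.insert n

/-- `Q_n^0(φ) = ⊤`, `Q_n^{k+1}(φ) = ⟨n⟩(φ ∧ Q_n^k(φ))` as formulas. -/
def Q (n : ℕ) (φ : Formula α) : ℕ → Formula α
  | 0 => top
  | k + 1 => dia n (and φ (Q n φ k))

/-- Propositional tautologies: formulas true under every assignment of truth values to formulas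
that commutes with the Boolean connectives. -/
def Tautology (φ : Formula α) : Prop :=
  ∀ t : Formula α → Prop, ¬ t bot → (∀ a b, t (imp a b) ↔ (t a → t b)) → t φ

end Formula

open Formula in
/-- Derivability in the logic GLP. -/
inductive Provable {α : Type u} : Formula α → Prop
  | taut (φ : Formula α) : Tautology φ → Provable φ
  | distr (n : ℕ) (φ ψ : Formula α) :
      Provable (imp (box n (imp φ ψ)) (imp (box n φ) (box n ψ)))
  | loeb (n : ℕ) (φ : Formula α) :
      Provable (imp (box n (imp (box n φ) φ)) (box n φ))
  | mono (m n : ℕ) (φ : Formula α) : m ≤ n → Provable (imp (box m φ) (box n φ))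
  | persist (m n : ℕ) (φ : Formula α) : m < n → Provable (imp (dia m φ) (box n (dia m φ)))
  | mp (φ ψ : Formula α) : Provable (imp φ ψ) → Provable φ → Provable ψ
  | nec (n : ℕ) (φ : Formula α) : Provable φ → Provable (box n φ)

/-! ### The Lindenbaum algebra of GLP -/

section Lindenbaum

variable {α : Type u}

open Formula

theorem Provable.of1 {a c : Formula α} (ha : Provable a) (h : Tautology (imp a c)) :
    Provable c := .mp _ _ (.taut _ h) ha

theorem Provable.of2 {a b c : Formula α} (ha : Provable a) (hb : Provable b)
    (h : Tautology (imp a (imp b c))) : Provable c := .mp _ _ (Provable.of1 ha h) hb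

theorem Provable.box_imp {a b : Formula α} (n : ℕ) (h : Provable (imp a b)) :
    Provable (imp (box n a) (box n b)) := .mp _ _ (.distr n a b) (.nec n _ h)

theorem Provable.dia_imp {a b : Formula α} (n : ℕ) (h : Provable (imp a b)) :
    Provable (imp (dia n a) (dia n b)) := by
  have h1 : Provable (imp (neg b) (neg a)) :=
    Provable.of1 h (fun t hb hi => by simp only [neg, hi]; tauto)
  exact Provable.of1 (Provable.box_imp n h1) (fun t hb hi => by simp only [dia, neg, hi]; tauto)

/-- GLP-provable equivalence of formulas. -/
def provEquiv (α : Type u) : Setoid (Formula α) where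
  r φ ψ := Provable (imp φ ψ) ∧ Provable (imp ψ φ)
  iseqv :=
    { refl := fun φ => ⟨.taut _ (fun t hb hi => by simp only [hi]; tauto),
        .taut _ (fun t hb hi => by simp only [hi]; tauto)⟩
      symm := fun h => ⟨h.2, h.1⟩
      trans := fun h k =>
        ⟨Provable.of2 h.1 k.1 (fun t hb hi => by simp only [hi]; tauto),
          Provable.of2 h.2 k.2 (fun t hb hi => by simp only [hi]; tauto)⟩ }

/-- The Lindenbaum algebra of GLP with variables in `α`: formulas modulo provable equivalence. -/
def Lindenbaum (α : Type u) : Type u := Quotient (provEquiv α)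

/-- The class of a formula. -/
def cls (φ : Formula α) : Lindenbaum α := Quotient.mk (provEquiv α) φ

/-- The generators: classes of the variables. -/
def gen (a : α) : Lindenbaum α := cls (var a)

theorem cls_eq {φ ψ : Formula α} (h : Provable (imp φ ψ)) (k : Provable (imp ψ φ)) :
    cls φ = cls ψ := Quotient.sound (s := provEquiv α) ⟨h, k⟩

namespace Lindenbaum

instance : LE (Lindenbaum α) where
  le := Quotient.lift₂ (s₁ := provEquiv α) (s₂ := provEquiv α) (fun φ ψ => Provable (imp φ ψ))
    (fun a b c d h k => propext
      ⟨fun q => Provable.of2 (Provable.of2 h.2 q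
          (c := imp c b) (fun t hb hi => by simp only [hi]; tauto)) k.1
          (fun t hb hi => by simp only [hi]; tauto),
        fun q => Provable.of2 (Provable.of2 h.1 q
          (c := imp a d) (fun t hb hi => by simp only [hi]; tauto)) k.2
          (fun t hb hi => by simp only [hi]; tauto)⟩)

theorem cls_le {φ ψ : Formula α} : cls φ ≤ cls ψ ↔ Provable (imp φ ψ) := Iff.rfl

/-- Conjunction of classes. -/
def inf : Lindenbaum α → Lindenbaum α → Lindenbaum α :=
  Quotient.map₂ (sa := provEquiv α) (sb := provEquiv α) (sc := provEquiv α) Formula.and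
    (fun _ _ h _ _ k =>
      ⟨Provable.of2 h.1 k.1 (fun t hb hi => by simp only [Formula.and, neg, hi]; tauto),
        Provable.of2 h.2 k.2 (fun t hb hi => by simp only [Formula.and, neg, hi]; tauto)⟩)

/-- Disjunction of classes. -/
def sup : Lindenbaum α → Lindenbaum α → Lindenbaum α :=
  Quotient.map₂ (sa := provEquiv α) (sb := provEquiv α) (sc := provEquiv α) Formula.or
    (fun _ _ h _ _ k =>
      ⟨Provable.of2 h.1 k.1 (fun t hb hi => by simp only [Formula.or, neg, hi]; tauto),
        Provable.of2 h.2 k.2 (fun t hb hi => by simp only [Formula.or, neg, hi]; tauto)⟩)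

/-- Negation of classes. -/
def compl : Lindenbaum α → Lindenbaum α :=
  Quotient.map (sa := provEquiv α) (sb := provEquiv α) Formula.neg
    (fun _ _ h =>
      ⟨Provable.of1 h.2 (fun t hb hi => by simp only [neg, hi]; tauto),
        Provable.of1 h.1 (fun t hb hi => by simp only [neg, hi]; tauto)⟩)

/-- The operation `⟨n⟩` on classes. -/
def diam (n : ℕ) : Lindenbaum α → Lindenbaum α :=
  Quotient.map (sa := provEquiv α) (sb := provEquiv α) (Formula.dia n)
    (fun _ _ h => ⟨Provable.dia_imp n h.1, Provable.dia_imp n h.2⟩)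

theorem ind {p : Lindenbaum α → Prop} (h : ∀ φ, p (cls φ)) (x : Lindenbaum α) : p x :=
  Quotient.ind (s := provEquiv α) h x

instance : BooleanAlgebra (Lindenbaum α) where
  le := (· ≤ ·)
  le_refl := ind fun a => cls_le.2 (.taut _ fun t hb hi => by simp only [hi]; tauto)
  le_trans := ind fun a => ind fun b => ind fun c => fun h k =>
    cls_le.2 (Provable.of2 (cls_le.1 h) (cls_le.1 k) fun t hb hi => by simp only [hi]; tauto)
  le_antisymm := ind fun a => ind fun b => fun h k => cls_eq (cls_le.1 h) (cls_le.1 k)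
  sup := sup
  le_sup_left := ind fun a => ind fun b =>
    cls_le.2 (.taut _ fun t hb hi => by simp only [Formula.or, neg, hi]; tauto)
  le_sup_right := ind fun a => ind fun b =>
    cls_le.2 (.taut _ fun t hb hi => by simp only [Formula.or, neg, hi]; tauto)
  sup_le := ind fun a => ind fun b => ind fun c => fun h k =>
    cls_le.2 (Provable.of2 (cls_le.1 h) (cls_le.1 k)
      fun t hb hi => by simp only [Formula.or, neg, hi]; tauto)
  inf := inf
  inf_le_left := ind fun a => ind fun b =>
    cls_le.2 (.taut _ fun t hb hi => by simp only [Formula.and, neg, hi]; tauto)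
  inf_le_right := ind fun a => ind fun b =>
    cls_le.2 (.taut _ fun t hb hi => by simp only [Formula.and, neg, hi]; tauto)
  le_inf := ind fun a => ind fun b => ind fun c => fun h k =>
    cls_le.2 (Provable.of2 (cls_le.1 h) (cls_le.1 k)
      fun t hb hi => by simp only [Formula.and, neg, hi]; tauto)
  le_sup_inf := ind fun a => ind fun b => ind fun c =>
    cls_le.2 (.taut _ fun t hb hi => by simp only [Formula.and, Formula.or, neg, hi]; tauto)
  top := cls Formula.top
  bot := cls Formula.bot
  le_top := ind fun a => cls_le.2 (.taut _ fun t hb hi => by simp only [Formula.top, neg, hi]; tauto)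
  bot_le := ind fun a => cls_le.2 (.taut _ fun t hb hi => by simp only [hi]; tauto)
  compl := compl
  inf_compl_le_bot := ind fun a =>
    cls_le.2 (.taut _ fun t hb hi => by simp only [Formula.and, neg, hi]; tauto)
  top_le_sup_compl := ind fun a =>
    cls_le.2 (.taut _ fun t hb hi => by simp only [Formula.or, Formula.top, neg, hi]; tauto)

instance : GLPAlgebra (Lindenbaum α) where
  dia := diam
  dia_sup n := ind fun a => ind fun b => by
    refine cls_eq ?_ ?_
    · have h1 : Provable (imp (neg a) (imp (neg b) (neg (Formula.or a b)))) :=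
        .taut _ fun t hb hi => by simp only [Formula.or, neg, hi]; tauto
      have h2 := Provable.of2 (Provable.box_imp n h1) (Provable.distr n (neg b) (neg (a.or b)))
        (c := imp (box n (neg a)) (imp (box n (neg b)) (box n (neg (a.or b)))))
        fun t hb hi => by simp only [hi]; tauto
      exact Provable.of1 h2 fun t hb hi => by simp only [dia, Formula.or, neg, hi]; tauto
    · have h1 : Provable (imp a (a.or b)) :=
        .taut _ fun t hb hi => by simp only [Formula.or, neg, hi]; tauto
      have h2 : Provable (imp b (a.or b)) :=
        .taut _ fun t hb hi => by simp only [Formula.or, neg, hi]; tauto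
      exact Provable.of2 (Provable.dia_imp n h1) (Provable.dia_imp n h2)
        fun t hb hi => by
          have e : ∀ x y : Formula α, t (x.or y) ↔ (t x ∨ t y) := fun x y => by
            simp only [Formula.or, neg, hi]; tauto
          simp only [hi, e]; tauto
  dia_bot n := by
    refine cls_eq ?_ ?_
    · have h : Provable (neg (bot : Formula α)) :=
        .taut _ fun t hb hi => by simp only [neg, hi]; tauto
      exact Provable.of1 (.nec n _ h) fun t hb hi => by simp only [dia, neg, hi]; tauto
    · exact .taut _ fun t hb hi => by simp only [hi]; tauto
  dia_loeb n := ind fun a => by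
    refine cls_eq ?_ ?_
    · have h1 : Provable (imp (neg (a.and (neg (dia n a)))) (imp (box n (neg a)) (neg a))) :=
        .taut _ fun t hb hi => by simp only [Formula.and, dia, neg, hi]; tauto
      exact Provable.of2 (Provable.box_imp n h1) (Provable.loeb n (neg a))
        fun t hb hi => by
          have e : ∀ x : Formula α, t (dia n x) ↔ ¬ t (box n (neg x)) := fun x => by
            simp only [dia, neg, hi]; tauto
          simp only [hi, e]; tauto
    · exact Provable.dia_imp n
        (.taut _ fun t hb hi => by simp only [Formula.and, neg, hi]; tauto)
  dia_anti m n := ind fun a => fun h => cls_le.2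
    (Provable.of1 (.mono m n (neg a) h) fun t hb hi => by simp only [dia, neg, hi]; tauto)
  dia_le_box_dia m n := ind fun a => fun h => cls_le.2 (by
    have h1 : Provable (imp (dia m a) (neg (neg (dia m a)))) :=
      .taut _ fun t hb hi => by simp only [dia, neg, hi]; tauto
    exact Provable.of2 (Provable.persist m n a h) (Provable.box_imp n h1)
      fun t hb hi => by
        have e : ∀ x : Formula α, t (neg (dia n x)) ↔ t (box n (neg x)) := fun x => by
          simp only [dia, neg, hi]; tauto
        change t (imp _ (imp _ (imp _ (neg (dia n (neg (dia m a)))))))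
        simp only [hi, e]; tauto)

end Lindenbaum

end Lindenbaum

end GLP

/-!
Suppose `⟨n + 1⟩x ≤ ⟨n⟩z` in a free GLP-algebra, but no `Q_n^k(x)` is below `⟨n⟩z`. The elements of
finite `n`-height, those `a` with `Q_n^k(a) = ⊥` for some `k`, form an ideal by a pigeonhole
argument, and `x ⊓ (⟨n⟩z)ᶜ` is not in it. An ultrafilter through `x ⊓ (⟨n⟩z)ᶜ` that avoids the
ideal sees itself by `R_n`, because `a ⊓ (⟨n⟩a)ᶜ` always lies in the ideal. Hence it is consistent
to add a new point that sees what the ultrafilter sees and, by `R_{n + 1}`, the ultrafilter itself.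
At this point `⟨n + 1⟩x` holds and `⟨n⟩z` fails. By freeness the projection of the enlarged algebra
has a section, and this section would preserve `⟨n + 1⟩x ≤ ⟨n⟩z`.

For the uniform bound, there are only finitely many formulas of bounded depth up to provable
equivalence once the variables and modalities are fixed. Relabelling the modalities by a strictly
monotone map preserves provability, and by Dickson's lemma the relabellings of a fixed finite set
of modalities are well-quasi-ordered by factorization. So in every sequence
of instances some instance inherits the bounds of an earlier one, which is impossible if no bound
works for all of them.
-/

namespace GLP

/-! ### Semantics in GLP-algebras -/

theorem exists_boundedLatticeHom_prop {B : Type u} [DistribLattice B] [BoundedOrder B]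
    (I : Order.Ideal B) {a : B} (ha : a ∉ I) :
    ∃ v : BoundedLatticeHom B Prop, v a ∧ ∀ b ∈ I, ¬ v b := by
  have hdisj : Disjoint ((Order.PFilter.principal a : Order.PFilter B) : Set B) (I : Set B) :=
    Set.disjoint_left.2 fun b hab hb => ha (I.lower hab hb)
  obtain ⟨J, hJ, hIJ, hJa⟩ := DistribLattice.prime_ideal_of_disjoint_filter_ideal hdisj
  have hinf (x y : B) : x ⊓ y ∈ J ↔ x ∈ J ∨ y ∈ J :=
    ⟨hJ.mem_or_mem, Or.rec (J.lower inf_le_left) (J.lower inf_le_right)⟩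
  let v : BoundedLatticeHom B Prop :=
    { toFun := fun b => b ∉ J
      map_sup' := fun x y => by simp only [Order.Ideal.sup_mem_iff, not_and_or]; rfl
      map_inf' := fun x y => by simp only [hinf, not_or]; rfl
      map_top' := by simpa using hJ.toIsProper.top_notMem
      map_bot' := by simp }
  exact ⟨v, Set.disjoint_left.1 hJa (le_refl a), fun b hb hbJ => hbJ (hIJ hb)⟩

section Algebra

open GLPAlgebra

variable {M : Type u} [GLPAlgebra M]

theorem dia_mono (n : ℕ) : Monotone (dia n : M → M) := fun x y h => by
  rw [← sup_eq_right.2 h, dia_sup]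
  exact le_sup_left

theorem dia_dia_le (n : ℕ) (x : M) : dia n (dia n x) ≤ dia n x :=
  calc dia n (dia n x)
    _ ≤ dia n (x ⊔ dia n x) := dia_mono n le_sup_right
    _ = dia n ((x ⊔ dia n x) ⊓ (dia n (x ⊔ dia n x))ᶜ) := dia_loeb n _
    _ ≤ dia n ((x ⊔ dia n x) ⊓ (dia n x)ᶜ) :=
        dia_mono n (inf_le_inf_left _ (compl_le_compl (dia_mono n le_sup_left)))
    _ ≤ dia n x := dia_mono n (by simp [inf_sup_right])

end Algebra

namespace GLPHom

variable {M : Type u} {N : Type v} [GLPAlgebra M] [GLPAlgebra N]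

theorem ext {h k : GLPHom M N} (e : ∀ x, h.toFun x = k.toFun x) : h = k := by
  obtain ⟨h, _⟩ := h
  obtain ⟨k, _⟩ := k
  obtain rfl : h = k := DFunLike.ext _ _ e
  rfl

theorem map_compl (h : GLPHom M N) (x : M) : h.toFun xᶜ = (h.toFun x)ᶜ :=
  map_compl' h.toBoundedLatticeHom x

end GLPHom

section Eval

open Formula

variable {α : Type u} {N : Type w} [GLPAlgebra N] (f : α → N)

/-- The value of a formula in a GLP-algebra, under the valuation `f` of the variables. -/
def eval : Formula α → N
  | var a => f a
  | bot => ⊥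
  | imp φ ψ => (eval φ)ᶜ ⊔ eval ψ
  | box n φ => (GLPAlgebra.dia n (eval φ)ᶜ)ᶜ

theorem eval_and (φ ψ : Formula α) : eval f (φ.and ψ) = eval f φ ⊓ eval f ψ := by
  simp [Formula.and, neg, eval]

theorem eval_or (φ ψ : Formula α) : eval f (φ.or ψ) = eval f φ ⊔ eval f ψ := by
  simp [Formula.or, neg, eval]

theorem eval_dia (n : ℕ) (φ : Formula α) :
    eval f (dia n φ) = GLPAlgebra.dia n (eval f φ) := by
  simp [dia, neg, eval]

theorem eval_imp_eq_top {φ ψ : Formula α} : eval f (imp φ ψ) = ⊤ ↔ eval f φ ≤ eval f ψ := by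
  rw [eval, sup_comm, ← himp_eq, himp_eq_top_iff]

theorem eval_tautology {φ : Formula α} (h : Tautology φ) : eval f φ = ⊤ := by
  rw [← compl_eq_bot, ← Order.Ideal.mem_principal.trans le_bot_iff]
  by_contra hφ
  obtain ⟨v, hv, -⟩ := exists_boundedLatticeHom_prop _ hφ
  rw [map_compl'] at hv
  exact hv (h (fun χ => v (eval f χ)) (by simp [eval]) (by simp [eval, imp_iff_not_or]))

theorem eval_distr (n : ℕ) (φ ψ : Formula α) :
    eval f (imp (box n (imp φ ψ)) (imp (box n φ) (box n ψ))) = ⊤ := by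
  have hdia : GLPAlgebra.dia n (eval f ψ)ᶜ ≤
      GLPAlgebra.dia n (eval f φ ⊓ (eval f ψ)ᶜ) ⊔ GLPAlgebra.dia n (eval f φ)ᶜ := by
    rw [← GLPAlgebra.dia_sup]
    exact dia_mono n (by simp [sup_inf_right])
  rw [eval_imp_eq_top]
  simp only [eval, compl_sup, compl_compl]
  rwa [← himp_eq, le_himp_iff, inf_comm, ← sdiff_eq, sdiff_le_iff]

theorem eval_loeb (n : ℕ) (φ : Formula α) :
    eval f (imp (box n (imp (box n φ) φ)) (box n φ)) = ⊤ := by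
  rw [eval_imp_eq_top]
  simp only [eval, compl_le_compl_iff_le, compl_sup, compl_compl]
  rw [inf_comm]
  exact (GLPAlgebra.dia_loeb n _).le

theorem eval_provable {φ : Formula α} (h : Provable φ) : eval f φ = ⊤ := by
  induction h with
  | taut φ h => exact eval_tautology f h
  | distr n φ ψ => exact eval_distr f n φ ψ
  | loeb n φ => exact eval_loeb f n φ
  | mono m n φ h =>
    exact (eval_imp_eq_top f).2 (compl_le_compl (GLPAlgebra.dia_anti m n _ h))
  | persist m n φ h =>
    rw [eval_imp_eq_top, eval, eval_dia]
    exact GLPAlgebra.dia_le_box_dia m n _ h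
  | mp φ ψ _ _ hφψ hφ => rwa [eval_imp_eq_top, hφ, top_le_iff] at hφψ
  | nec n φ _ h => simp [eval, h, GLPAlgebra.dia_bot]

/-- Evaluation as a homomorphism from the Lindenbaum algebra. -/
def lift : GLPHom (Lindenbaum α) N where
  toFun := Quotient.lift (s := provEquiv α) (eval f) fun _ _ h =>
    le_antisymm ((eval_imp_eq_top f).1 (eval_provable f h.1))
      ((eval_imp_eq_top f).1 (eval_provable f h.2))
  map_sup' := Lindenbaum.ind fun φ => Lindenbaum.ind fun ψ => eval_or f φ ψ
  map_inf' := Lindenbaum.ind fun φ => Lindenbaum.ind fun ψ => eval_and f φ ψ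
  map_top' := show eval f top = ⊤ by simp [top, neg, eval]
  map_bot' := rfl
  map_dia n := Lindenbaum.ind fun φ => eval_dia f n φ

end Eval

section Lindenbaum

open Formula

variable {α : Type u}

theorem cls_imp (φ ψ : Formula α) : cls (imp φ ψ) = (cls φ)ᶜ ⊔ cls ψ :=
  cls_eq (.taut _ fun t hb hi => by simp only [Formula.or, neg, hi]; tauto)
    (.taut _ fun t hb hi => by simp only [Formula.or, neg, hi]; tauto)

theorem cls_dia (n : ℕ) (φ : Formula α) : cls (dia n φ) = GLPAlgebra.dia n (cls φ) := rfl

theorem cls_neg (φ : Formula α) : cls (neg φ) = (cls φ)ᶜ := rfl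

theorem cls_box (n : ℕ) (φ : Formula α) : cls (box n φ) = (GLPAlgebra.dia n (cls φ)ᶜ)ᶜ := by
  rw [← cls_neg, ← cls_dia, ← cls_neg]
  have h₁ : Provable (imp φ (neg (neg φ))) := .taut _ fun t hb hi => by simp only [neg, hi]; tauto
  have h₂ : Provable (imp (neg (neg φ)) φ) := .taut _ fun t hb hi => by simp only [neg, hi]; tauto
  exact cls_eq
    (.of1 (.box_imp n h₁) fun t hb hi => by simp only [dia, neg, hi]; tauto)
    (.of1 (.box_imp n h₂) fun t hb hi => by simp only [dia, neg, hi]; tauto)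

theorem isFreeOn_gen (α : Type u) : IsFreeOn.{u, u, w} (gen (α := α)) := by
  intro N _ f
  refine ⟨lift f, fun _ => rfl, fun h hh => GLPHom.ext (Lindenbaum.ind fun φ => ?_)⟩
  change h.toFun (cls φ) = eval f φ
  induction φ with
  | var a => exact hh a
  | bot => exact h.map_bot'
  | imp φ ψ ihφ ihψ =>
    rw [cls_imp, eval, ← ihφ, ← ihψ, ← GLPHom.map_compl]
    exact h.map_sup' _ _
  | box n φ ih => rw [cls_box, eval, ← ih, GLPHom.map_compl, h.map_dia, GLPHom.map_compl]

end Lindenbaum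

/-! ### The reduction property of free algebras -/

section FiniteHeight

open GLPAlgebra

variable {M : Type u} [GLPAlgebra M] (n : ℕ)

theorem algQ_mono (k : ℕ) : Monotone fun x : M => algQ n x k := by
  intro x y h
  induction k with
  | zero => exact le_rfl
  | succ k ih => exact dia_mono n (inf_le_inf h ih)

theorem algQ_antitone (x : M) : Antitone (algQ n x) :=
  antitone_nat_of_succ_le fun k => by
    induction k with
    | zero => exact le_top
    | succ k ih => exact dia_mono n (inf_le_inf_left x ih)

theorem dia_inf_le_algQ_sup_algQ {a b q : M} {i j : ℕ} (h : q ≤ algQ n a i ⊔ algQ n b (j + 1)) :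
    dia n (a ⊓ q) ≤ algQ n a (i + 1) ⊔ algQ n b (j + 1) :=
  calc dia n (a ⊓ q)
    _ ≤ dia n ((a ⊓ algQ n a i) ⊔ algQ n b (j + 1)) :=
        dia_mono n ((inf_le_inf_left a h).trans (by
          rw [inf_sup_left]
          exact sup_le_sup_left inf_le_right _))
    _ = algQ n a (i + 1) ⊔ dia n (algQ n b (j + 1)) := dia_sup n _ _
    _ ≤ algQ n a (i + 1) ⊔ algQ n b (j + 1) := sup_le_sup_left (dia_dia_le n _) _

-- Pigeonhole: of `k` consecutive steps inside `a ⊔ b`, either `i` land in `a` or `j` land in `b`.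
theorem algQ_sup_le (a b : M) {i j k : ℕ} (h : i + j ≤ k + 1) :
    algQ n (a ⊔ b) k ≤ algQ n a i ⊔ algQ n b j := by
  induction k generalizing i j with
  | zero =>
    obtain rfl | rfl : i = 0 ∨ j = 0 := by lia
    · exact le_top.trans le_sup_left
    · exact le_top.trans le_sup_right
  | succ k ih =>
    rcases i with - | i
    · exact le_top.trans le_sup_left
    rcases j with - | j
    · exact le_top.trans le_sup_right
    rw [algQ, inf_sup_right, dia_sup]
    have ha : algQ n (a ⊔ b) k ≤ algQ n a i ⊔ algQ n b (j + 1) := ih (by lia)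
    have hb : algQ n (a ⊔ b) k ≤ algQ n b j ⊔ algQ n a (i + 1) :=
      (ih (by lia)).trans_eq (sup_comm _ _)
    exact sup_le (dia_inf_le_algQ_sup_algQ n ha)
      ((dia_inf_le_algQ_sup_algQ n hb).trans_eq (sup_comm _ _))

variable (M) in
/-- The ideal of the elements `a` of finite `n`-height: the `R_n`-chains of points of `a` in the
dual space have bounded length. -/
def finiteHeightIdeal : Order.Ideal M where
  carrier := {a | ∃ k, algQ n a k = ⊥}
  lower' := fun _ _ hba ⟨k, hk⟩ => ⟨k, le_bot_iff.1 (hk ▸ algQ_mono n k hba)⟩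
  nonempty' := ⟨⊥, 1, by simp [algQ, dia_bot]⟩
  directed' := fun a ⟨i, hi⟩ b ⟨j, hj⟩ =>
    ⟨a ⊔ b, ⟨i + j, le_bot_iff.1 ((algQ_sup_le n a b (Nat.le_succ _)).trans (by simp [hi, hj]))⟩,
      le_sup_left, le_sup_right⟩

theorem inf_compl_dia_mem_finiteHeightIdeal (x : M) :
    x ⊓ (dia n x)ᶜ ∈ finiteHeightIdeal M n := by
  refine ⟨2, ?_⟩
  have hdisj : (x ⊓ (dia n x)ᶜ) ⊓ dia n (x ⊓ (dia n x)ᶜ) = ⊥ := by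
    rw [← dia_loeb, inf_assoc, compl_inf_self, inf_bot_eq]
  simp only [algQ, inf_top_eq, hdisj, dia_bot]

variable {n} in
theorem exists_algQ_le_dia_of_mem_finiteHeightIdeal {x z : M}
    (h : x ⊓ (dia n z)ᶜ ∈ finiteHeightIdeal M n) : ∃ k, algQ n x k ≤ dia n z := by
  obtain ⟨k, hk⟩ := h
  refine ⟨k, ?_⟩
  calc algQ n x k
    _ ≤ algQ n (x ⊓ (dia n z)ᶜ ⊔ dia n z) k := algQ_mono n k (by simp [sup_inf_right])
    _ ≤ algQ n (x ⊓ (dia n z)ᶜ) k ⊔ algQ n (dia n z) 1 := algQ_sup_le n _ _ le_rfl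
    _ = dia n (dia n z) := by simp [hk, algQ]
    _ ≤ dia n z := dia_dia_le n z

end FiniteHeight

section ExternalPoint

open GLPAlgebra

/-- A point outside the dual space of `M`, given by the truth values `sat n x` of `⟨n⟩ x` at it.
The axioms are those of GLP-algebras, read at this point. -/
structure ExternalPoint (M : Type u) [GLPAlgebra M] where
  sat : ℕ → M → Prop
  sat_sup (n : ℕ) (x y : M) : sat n (x ⊔ y) ↔ sat n x ∨ sat n y
  not_sat_bot (n : ℕ) : ¬ sat n ⊥
  sat_loeb (n : ℕ) (x : M) : sat n x → sat n (x ⊓ (dia n x)ᶜ)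
  sat_anti (m n : ℕ) (x : M) : m ≤ n → sat n x → sat m x
  sat_persist (m n : ℕ) (x : M) : m < n → sat m x → ¬ sat n (dia m x)ᶜ

variable {M : Type u} [GLPAlgebra M]

namespace ExternalPoint

/-- The GLP-algebra obtained by adding the external point `p` to the dual space of `M`: pairs of an
element of `M` and a truth value at `p`. No point of `M` sees `p`, nor does `p` see itself. -/
def Extension (_p : ExternalPoint M) : Type u := M × Prop

variable (p : ExternalPoint M)

instance : BooleanAlgebra p.Extension := inferInstanceAs (BooleanAlgebra (M × Prop))

instance : GLPAlgebra p.Extension where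
  dia n x := (dia n x.1, p.sat n x.1)
  dia_sup n x y := Prod.ext (dia_sup n x.1 y.1) (propext (p.sat_sup n x.1 y.1))
  dia_bot n := Prod.ext (dia_bot n) (eq_false (p.not_sat_bot n))
  dia_loeb n x := Prod.ext (dia_loeb n x.1) (propext ⟨p.sat_loeb n x.1, fun h => by
    rw [← sup_inf_self (a := x.1) (b := (dia n x.1)ᶜ)]
    exact (p.sat_sup n _ _).2 (.inr h)⟩)
  dia_anti m n x h := ⟨dia_anti m n x.1 h, p.sat_anti m n x.1 h⟩
  dia_le_box_dia m n x h := ⟨dia_le_box_dia m n x.1 h, p.sat_persist m n x.1 h⟩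

/-- Restriction of the elements of the extension to the dual space of `M`. -/
def proj : GLPHom p.Extension M where
  toFun := Prod.fst
  map_sup' _ _ := rfl
  map_inf' _ _ := rfl
  map_top' := rfl
  map_bot' := rfl
  map_dia _ _ := rfl

end ExternalPoint

end ExternalPoint

section Projectivity

/-- The identity homomorphism of a GLP-algebra. -/
def GLPHom.id (M : Type u) [GLPAlgebra M] : GLPHom M M where
  toBoundedLatticeHom := BoundedLatticeHom.id M
  map_dia _ _ := rfl

/-- The composite of two homomorphisms of GLP-algebras. -/
def GLPHom.comp {M N P : Type*} [GLPAlgebra M] [GLPAlgebra N] [GLPAlgebra P]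
    (h : GLPHom N P) (k : GLPHom M N) : GLPHom M P where
  toBoundedLatticeHom := h.toBoundedLatticeHom.comp k.toBoundedLatticeHom
  map_dia n x := (congrArg h.toFun (k.map_dia n x)).trans (h.map_dia n _)

variable {α : Type u} {M : Type v} [GLPAlgebra M] {g : α → M}

theorem IsFreeOn.exists_rightInverse_of_surjective (hg : IsFreeOn.{u, v, v} g)
    {N : Type v} [GLPAlgebra N] (p : GLPHom N M) (hp : Function.Surjective p.toFun) :
    ∃ h : GLPHom M N, Function.RightInverse h.toFun p.toFun := by
  choose f hf using fun a => hp (g a)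
  obtain ⟨h, hh, -⟩ := hg N f
  have hcomp : p.comp h = GLPHom.id M :=
    (hg M g).unique (fun a => (congrArg p.toFun (hh a)).trans (hf a)) fun _ => rfl
  exact ⟨h, fun x => congrArg (fun q : GLPHom M M => q.toFun x) hcomp⟩

open GLPAlgebra in
-- A section of `p.proj` preserves the order, also in the coordinate of the new point.
theorem IsFreeOn.sat_of_dia_le (hg : IsFreeOn.{u, v, v} g) (p : ExternalPoint M) {m n : ℕ}
    {x z : M} (hle : dia n x ≤ dia m z) (hx : p.sat n x) : p.sat m z := by
  obtain ⟨h, hh⟩ := hg.exists_rightInverse_of_surjective p.proj fun y => ⟨(y, False), rfl⟩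
  have hle' : h.toFun (dia n x) ≤ h.toFun (dia m z) :=
    OrderHomClass.mono h.toBoundedLatticeHom hle
  rw [h.map_dia, h.map_dia] at hle'
  have hsat : p.sat n (h.toFun x).1 → p.sat m (h.toFun z).1 := hle'.2
  rw [show (h.toFun x).1 = x from hh x, show (h.toFun z).1 = z from hh z] at hsat
  exact hsat hx

end Projectivity

section Reduction

open GLPAlgebra

variable {M : Type v} [GLPAlgebra M]

/-- The external point that sees by `R_j`, for `j ≤ n`, what the ultrafilter `v` sees, and by
`R_{n+1}` moreover `v` itself; this requires `v` to see itself by `R_n`. -/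
def ExternalPoint.ofReflexive (n : ℕ) (v : BoundedLatticeHom M Prop)
    (hv : ∀ a, v a → v (dia n a)) : ExternalPoint M where
  sat j a := (j ≤ n ∧ v (dia j a)) ∨ (j = n + 1 ∧ (v a ∨ v (dia (n + 1) a)))
  sat_sup j a b := by
    simp only [dia_sup, map_sup, sup_Prop_eq]
    tauto
  not_sat_bot j := by simp [dia_bot]
  sat_loeb j a := by
    rintro (⟨hj, ha⟩ | ⟨rfl, ha⟩)
    · exact .inl ⟨hj, by rwa [← dia_loeb]⟩
    · rw [← dia_loeb, map_inf, map_compl']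
      by_cases h : v (dia (n + 1) a)
      · exact .inr ⟨rfl, .inr h⟩
      · exact .inr ⟨rfl, .inl ⟨ha.resolve_right h, h⟩⟩
  sat_anti i j a hij := by
    have hanti {l : ℕ} (hl : i ≤ l) : v (dia l a) → v (dia i a) :=
      OrderHomClass.mono v (dia_anti i l a hl)
    rintro (⟨hj, ha⟩ | ⟨rfl, ha⟩)
    · exact .inl ⟨hij.trans hj, hanti hij ha⟩
    · obtain hi | rfl := hij.lt_or_eq
      · have hin : i ≤ n := Nat.lt_succ_iff.1 hi
        exact .inl ⟨hin, ha.elim (fun ha => hanti hin (hv a ha)) (hanti hij)⟩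
      · exact .inr ⟨rfl, ha⟩
  sat_persist i j a hij hi := by
    obtain ⟨-, hi⟩ | ⟨rfl, -⟩ := hi
    · have hbox : ¬ v (dia j (dia i a)ᶜ) := by
        have := OrderHomClass.mono v (dia_le_box_dia i j a hij) hi
        rwa [map_compl', compl_iff_not] at this
      rintro (⟨-, h⟩ | ⟨rfl, h | h⟩)
      · exact hbox h
      · rw [map_compl', compl_iff_not] at h
        exact h hi
      · exact hbox h
    · lia

variable {α : Type u} {g : α → M}

theorem IsFreeOn.exists_algQ_le_dia (hg : IsFreeOn.{u, v, v} g) {n : ℕ} {x z : M}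
    (hle : dia (n + 1) x ≤ dia n z) : ∃ k, algQ n x k ≤ dia n z := by
  refine exists_algQ_le_dia_of_mem_finiteHeightIdeal ?_
  by_contra hmem
  obtain ⟨v, hxz, hheight⟩ := exists_boundedLatticeHom_prop _ hmem
  rw [map_inf, map_compl'] at hxz
  obtain ⟨hx, hz⟩ : v x ∧ ¬ v (dia n z) := hxz
  have hrefl (a : M) (ha : v a) : v (dia n a) := by
    by_contra hda
    refine hheight _ (inf_compl_dia_mem_finiteHeightIdeal n a) ?_
    rw [map_inf, map_compl']
    exact ⟨ha, hda⟩
  have hsat := hg.sat_of_dia_le (.ofReflexive n v hrefl) hle (.inr ⟨rfl, .inl hx⟩)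
  obtain ⟨-, h⟩ | ⟨h, -⟩ := hsat
  · exact hz h
  · lia

theorem IsFreeOn.reductionProperty (hg : IsFreeOn.{u, v, v} g) (n : ℕ) :
    ReductionProperty M n := by
  rintro x z ⟨F, hF, hFz⟩
  have hle : dia (n + 1) x ≤ dia n z :=
    (Finset.le_inf fun a ha => (Set.mem_singleton_iff.1 (hF ha)).ge).trans hFz
  obtain ⟨k, hk⟩ := hg.exists_algQ_le_dia hle
  exact ⟨{algQ n x k}, by simp, by simpa using hk⟩

end Reduction

/-! ### Translations of formulas -/

section Translate

open Formula

variable {α : Type u} {β : Type v} {γ : Type w}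

namespace Formula

/-- The translation that relabels the modalities by `e` and substitutes `σ a` for the variable
`a`. -/
def translate (e : ℕ → ℕ) (σ : α → Formula β) : Formula α → Formula β
  | var a => σ a
  | bot => bot
  | imp φ ψ => imp (translate e σ φ) (translate e σ ψ)
  | box n φ => box (e n) (translate e σ φ)

theorem translate_dia (e : ℕ → ℕ) (σ : α → Formula β) (n : ℕ) (φ : Formula α) :
    translate e σ (dia n φ) = dia (e n) (translate e σ φ) := rfl

theorem translate_Q (e : ℕ → ℕ) (σ : α → Formula β) (n : ℕ) (φ : Formula α) (k : ℕ) :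
    translate e σ (Q n φ k) = Q (e n) (translate e σ φ) k := by
  induction k with
  | zero => rfl
  | succ k ih => rw [Q, Q, ← ih]; rfl

theorem translate_translate (e : ℕ → ℕ) (e' : ℕ → ℕ) (σ : α → Formula β) (τ : β → Formula γ)
    (φ : Formula α) :
    translate e' τ (translate e σ φ) = translate (e' ∘ e) (fun a => translate e' τ (σ a)) φ := by
  induction φ with
  | var a => rfl
  | bot => rfl
  | imp φ ψ ihφ ihψ => simp only [translate, ihφ, ihψ]
  | box n φ ih => simp only [translate, ih, Function.comp]

theorem translate_congr {e e' : ℕ → ℕ} {σ σ' : α → Formula β} {φ : Formula α}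
    (he : ∀ n ∈ φ.mods, e n = e' n) (hσ : ∀ a ∈ φ.vars, σ a = σ' a) :
    translate e σ φ = translate e' σ' φ := by
  induction φ with
  | var a => exact hσ a rfl
  | bot => rfl
  | imp φ ψ ihφ ihψ =>
    rw [translate, translate, ihφ (fun n hn => he n (.inl hn)) fun a ha => hσ a (.inl ha),
      ihψ (fun n hn => he n (.inr hn)) fun a ha => hσ a (.inr ha)]
  | box n φ ih =>
    rw [translate, translate, he n (Set.mem_insert _ _),
      ih (fun n hn => he n (Set.mem_insert_of_mem _ hn)) hσ]

theorem translate_id_var (φ : Formula α) : translate id var φ = φ := by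
  induction φ with
  | var a => rfl
  | bot => rfl
  | imp φ ψ ihφ ihψ => rw [translate, ihφ, ihψ]
  | box n φ ih => rw [translate, ih, id]

theorem translate_translate_eq_self {e e' : ℕ → ℕ} {σ : α → Formula β} {τ : β → Formula α}
    {φ : Formula α} (he : ∀ n ∈ φ.mods, e' (e n) = n)
    (hσ : ∀ a ∈ φ.vars, translate e' τ (σ a) = var a) :
    translate e' τ (translate e σ φ) = φ := by
  rw [translate_translate]
  exact (translate_congr he hσ).trans φ.translate_id_var

theorem depth_translate (e : ℕ → ℕ) {σ : α → Formula β} (hσ : ∀ a, (σ a).depth = 0)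
    (φ : Formula α) : (translate e σ φ).depth = φ.depth := by
  induction φ with
  | var a => exact hσ a
  | bot => rfl
  | imp φ ψ ihφ ihψ => simp only [translate, depth, ihφ, ihψ]
  | box n φ ih => simp only [translate, depth, ih]

theorem mods_translate (e : ℕ → ℕ) {σ : α → Formula β} (hσ : ∀ a, (σ a).mods = ∅)
    (φ : Formula α) : (translate e σ φ).mods = e '' φ.mods := by
  induction φ with
  | var a => simp [translate, mods, hσ]
  | bot => simp [translate, mods]
  | imp φ ψ ihφ ihψ => simp only [translate, mods, ihφ, ihψ, Set.image_union]
  | box n φ ih => simp only [translate, mods, ih, Set.image_insert_eq]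

theorem exists_translate_eq_of_mods_subset_image {f : ℕ → ℕ} {s : Set ℕ} {φ : Formula α}
    (h : φ.mods ⊆ f '' s) :
    ∃ φ' : Formula α, φ'.depth = φ.depth ∧ φ'.mods ⊆ s ∧ translate f var φ' = φ := by
  refine ⟨translate (Function.invFunOn f s) var φ, depth_translate _ (fun _ => rfl) φ, ?_,
    translate_translate_eq_self (fun n hn => Function.invFunOn_eq (h hn)) fun _ _ => rfl⟩
  rw [mods_translate _ fun _ => rfl]
  rintro _ ⟨n, hn, rfl⟩
  exact Function.invFunOn_mem (h hn)

theorem exists_substitution_fin_ncard {V : Set α} (hV : V.Finite) :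
    ∃ (σ : α → Formula (Fin V.ncard)) (τ : Fin V.ncard → Formula α),
      (∀ a, (σ a).depth = 0) ∧ (∀ a, (σ a).mods = ∅) ∧ ∀ a ∈ V, translate id τ (σ a) = var a := by
  classical
  have : Finite V := hV
  let index : V ≃ Fin V.ncard := Finite.equivFinOfCardEq rfl
  let σ (a : α) : Formula (Fin V.ncard) := if h : a ∈ V then var (index ⟨a, h⟩) else bot
  refine ⟨σ, fun i => var (index.symm i), fun a => ?_, fun a => ?_, fun a ha => ?_⟩
  · by_cases h : a ∈ V <;> simp [σ, h, depth]
  · by_cases h : a ∈ V <;> simp [σ, h, mods]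
  · simp [σ, ha, translate]

end Formula

theorem Provable.translate {e : ℕ → ℕ} (he : StrictMono e) (σ : α → Formula β) {φ : Formula α}
    (h : Provable φ) : Provable (translate e σ φ) := by
  induction h with
  | taut φ h =>
    exact .taut _ fun t hb hi => h (fun χ => t (χ.translate e σ)) hb fun _ _ => hi _ _
  | distr n φ ψ => exact .distr _ _ _
  | loeb n φ => exact .loeb _ _
  | mono m n φ h => exact .mono _ _ _ (he.monotone h)
  | persist m n φ h => exact .persist _ _ _ (he h)
  | mp φ ψ _ _ hφψ hφ => exact .mp _ _ hφψ hφ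
  | nec n φ _ h => exact .nec _ _ h

theorem cls_translate_eq {e : ℕ → ℕ} (he : StrictMono e) (σ : α → Formula β) {φ ψ : Formula α}
    (h : cls φ = cls ψ) : cls (φ.translate e σ) = cls (ψ.translate e σ) :=
  cls_eq (.translate he σ (Lindenbaum.cls_le.1 h.le)) (.translate he σ (Lindenbaum.cls_le.1 h.ge))

theorem cls_Q (n : ℕ) (φ : Formula α) (k : ℕ) : cls (Q n φ k) = algQ n (cls φ) k := by
  induction k with
  | zero => rfl
  | succ k ih => rw [algQ, ← ih]; rfl

end Translate

/-! ### Finiteness up to provable equivalence -/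

section Finiteness

open Formula

theorem finite_booleanClosure {B : Type u} [BooleanAlgebra B] {s : Set B} (hs : s.Finite) :
    (BooleanSubalgebra.closure s : Set B).Finite := by
  let L : Set B := latticeClosure (s ∪ {⊥, ⊤})
  have hL : Finite L := (hs.union (Set.toFinite _)).latticeClosure
  have hbot : ⊥ ∈ L := subset_latticeClosure (by simp)
  have htop : ⊤ ∈ L := subset_latticeClosure (by simp)
  have hsL : s ⊆ L := Set.subset_union_left.trans subset_latticeClosure
  refine (Set.finite_range fun t : Finset (L × L) => t.sup fun x => x.1.1 \ x.2.1).subset ?_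
  intro a ha
  obtain ⟨t, rfl⟩ := (BooleanSubalgebra.mem_closure_iff_sup_sdiff isSublattice_latticeClosure
    hbot htop).1 (BooleanSubalgebra.closure_mono hsL ha)
  exact ⟨t, rfl⟩

variable {α : Type u}

theorem cls_mem_booleanClosure {d : ℕ} {s : Set ℕ} {φ : Formula α} (hd : φ.depth ≤ d)
    (hs : φ.mods ⊆ s) :
    cls φ ∈ BooleanSubalgebra.closure (Set.range gen ∪
      Set.image2 (fun n (c : Lindenbaum α) => (GLPAlgebra.dia n cᶜ)ᶜ) s
        (cls '' {φ | φ.depth < d ∧ φ.mods ⊆ s})) := by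
  induction φ with
  | var a => exact BooleanSubalgebra.subset_closure (.inl ⟨a, rfl⟩)
  | bot => exact BooleanSubalgebra.bot_mem
  | imp φ ψ ihφ ihψ =>
    rw [cls_imp]
    exact BooleanSubalgebra.sup_mem
      (BooleanSubalgebra.compl_mem
        (ihφ ((le_max_left _ _).trans hd) (Set.subset_union_left.trans hs)))
      (ihψ ((le_max_right _ _).trans hd) (Set.subset_union_right.trans hs))
  | box n φ _ =>
    rw [cls_box]
    exact BooleanSubalgebra.subset_closure (.inr ⟨n, hs (Set.mem_insert _ _), cls φ,
      ⟨φ, ⟨hd, (Set.subset_insert _ _).trans hs⟩, rfl⟩, rfl⟩)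

theorem finite_cls_image [Finite α] {s : Set ℕ} (hs : s.Finite) (d : ℕ) :
    (cls '' {φ : Formula α | φ.depth < d ∧ φ.mods ⊆ s}).Finite := by
  induction d with
  | zero => simp
  | succ d ih =>
    refine (finite_booleanClosure ((Set.finite_range gen).union (hs.image2
      (fun n (c : Lindenbaum α) => (GLPAlgebra.dia n cᶜ)ᶜ) ih))).subset ?_
    rintro _ ⟨φ, ⟨hd, hφ⟩, rfl⟩
    exact cls_mem_booleanClosure (Nat.lt_succ_iff.1 hd) hφ

end Finiteness

/-! ### The uniform bound -/

section WellQuasiOrder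

theorem exists_strictMono_comp_eq {ι : Type v} [Finite ι] {f g : ι → ℕ} (hle : f ≤ g)
    (hgap : ∀ i j, f i ≤ f j → g i - f i ≤ g j - f j) :
    ∃ e : ℕ → ℕ, StrictMono e ∧ ∀ i, e (f i) = g i := by
  have := Fintype.ofFinite ι
  let below (n : ℕ) : Finset ι := {i | f i ≤ n}
  let shift (n : ℕ) : ℕ := (below n).sup (g - f)
  have shift_mono : Monotone shift := fun a b hab =>
    Finset.sup_mono fun i hi => by simp only [below, Finset.mem_filter_univ] at *; lia
  have shift_f (j : ι) : shift (f j) = g j - f j :=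
    le_antisymm (Finset.sup_le fun i hi => hgap i j (Finset.mem_filter_univ i |>.1 hi))
      (Finset.le_sup (f := g - f) (Finset.mem_filter_univ j |>.2 le_rfl))
  exact ⟨fun n => n + shift n, strictMono_id.add_monotone shift_mono, fun i => by
    simp only [shift_f, Nat.add_sub_of_le (hle i)]⟩

theorem wellQuasiOrdered_orderEmbedding_nat {ι : Type v} [LinearOrder ι] [Finite ι] :
    WellQuasiOrdered fun f g : ι ↪o ℕ => ∃ e : ℕ → ℕ, StrictMono e ∧ ∀ i, e (f i) = g i := by
  intro f
  have dickson : WellQuasiOrdered fun a b : (ι → ℕ) × (ι → ι → ℕ) => a.1 ≤ b.1 ∧ a.2 ≤ b.2 :=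
    (WellQuasiOrdered.pi fun _ => wellQuasiOrdered_le).prod
      (WellQuasiOrdered.pi fun _ => WellQuasiOrdered.pi fun _ => wellQuasiOrdered_le)
  obtain ⟨m, n, hmn, hle, hgap⟩ := dickson fun k => (f k, fun i j => f k j - f k i)
  refine ⟨m, n, hmn, exists_strictMono_comp_eq hle fun i j hij => ?_⟩
  have hi : f m i ≤ f n i := hle i
  have hij' : f n i ≤ f n j := (f n).monotone ((f m).le_iff_le.1 hij)
  have hdiff : f m j - f m i ≤ f n j - f n i := hgap i j
  lia

theorem exists_orderEmbedding_nat_subset_image_Iio {S : Set ℕ} (hS : S.Finite) {N : ℕ}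
    (hN : S.ncard ≤ N) : ∃ f : ℕ ↪o ℕ, S ⊆ f '' Set.Iio N := by
  classical
  obtain ⟨b, hb⟩ := hS.bddAbove
  have : Infinite ↥(S ∪ Set.Ioi b) := ((Set.Ioi_infinite b).mono Set.subset_union_right).to_subtype
  let f := Nat.orderEmbeddingOfSet (S ∪ Set.Ioi b)
  have range_f : Set.range f = S ∪ Set.Ioi b := Nat.orderEmbeddingOfSet_range _
  refine ⟨f, fun n hn => ?_⟩
  obtain ⟨i, rfl⟩ : n ∈ Set.range f := range_f ▸ .inl hn
  have image_subset : f '' Set.Iic i ⊆ S := by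
    rintro _ ⟨j, hj, rfl⟩
    have hjS : f j ∈ S ∪ Set.Ioi b := range_f ▸ Set.mem_range_self j
    exact hjS.resolve_right ((f.monotone hj).trans (hb hn)).not_gt
  have card_le := Set.ncard_le_ncard image_subset hS
  rw [Set.ncard_image_of_injective _ f.injective, Set.ncard_Iic_nat] at card_le
  exact ⟨i, by simpa using card_le.trans hN, rfl⟩

theorem exists_uniform_of_partiallyWellOrderedOn {γ : Type v} {r : γ → γ → Prop} {s : Set γ}
    (hs : s.PartiallyWellOrderedOn r) {P : γ → ℕ → Prop} (hmono : ∀ a, Monotone (P a))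
    (hr : ∀ a b, r a b → P a ≤ P b) (hex : ∀ a ∈ s, ∃ k, P a k) : ∃ K, ∀ a ∈ s, P a K := by
  by_contra! hne
  choose a ha hnot using hne
  choose k hk using fun K => hex (a K) (ha K)
  have lt_k (K : ℕ) : K < k K := lt_of_not_ge fun hle => hnot K (hmono _ hle (hk K))
  let K (n : ℕ) : ℕ := k^[n] 0
  have K_strictMono : StrictMono K := strictMono_nat_of_lt_succ fun n => by
    simpa only [K, Function.iterate_succ_apply'] using lt_k _
  obtain ⟨m, n, hmn, hrel⟩ := hs fun n => ⟨a (K n), ha _⟩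
  refine hnot (K n) (hmono _ (K_strictMono.monotone hmn) ?_)
  simpa only [K, Function.iterate_succ_apply'] using hr _ _ hrel _ (hk (K m))

end WellQuasiOrder

/-- An instance `⟨m + 1⟩ψ ⊢ ⟨m⟩φ` of the reduction problem, where `m` is its `index`. -/
structure ReductionProblem (α : Type u) where
  index : ℕ
  φ : Formula α
  ψ : Formula α

namespace ReductionProblem

open Formula

variable {α : Type u}

/-- The set of modalities occurring in a reduction problem, including its index. -/
def labels (p : ReductionProblem α) : Set ℕ := insert p.index (p.φ.mods ∪ p.ψ.mods)

/-- The reduction problem obtained by relabelling the modalities. -/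
def relabel (e : ℕ → ℕ) (p : ReductionProblem α) : ReductionProblem α :=
  ⟨e p.index, p.φ.translate e var, p.ψ.translate e var⟩

/-- A reduction problem up to provable equivalence of its formulas. -/
def classes (p : ReductionProblem α) : ℕ × Lindenbaum α × Lindenbaum α :=
  (p.index, cls p.φ, cls p.ψ)

/-- Up to provable equivalence, `q` is obtained from `p` by an order-preserving relabelling. -/
def RelabelsTo (p q : ReductionProblem α) : Prop :=
  ∃ e : ℕ → ℕ, StrictMono e ∧ (p.relabel e).classes = q.classes

/-- The reduction problem has a solution with bound `k`, that is, `Q_m^k(ψ) ⊢ ⟨m⟩φ`. -/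
def SolvedBy (p : ReductionProblem α) (k : ℕ) : Prop :=
  algQ p.index (cls p.ψ) k ≤ GLPAlgebra.dia p.index (cls p.φ)

/-- The reduction problems with modal depth less than `d` and at most `N` modalities. -/
def bounded (α : Type u) (d N : ℕ) : Set (ReductionProblem α) :=
  {p | p.φ.depth < d ∧ p.ψ.depth < d ∧ p.labels.ncard ≤ N}

theorem relabel_relabel (e e' : ℕ → ℕ) (p : ReductionProblem α) :
    (p.relabel e).relabel e' = p.relabel (e' ∘ e) := by
  simp only [relabel, translate_translate, Formula.translate, Function.comp]

theorem relabel_congr {e e' : ℕ → ℕ} {p : ReductionProblem α} (h : ∀ n ∈ p.labels, e n = e' n) :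
    p.relabel e = p.relabel e' := by
  rw [relabel, relabel, h _ (Set.mem_insert _ _),
    translate_congr (fun n hn => h n (.inr (.inl hn))) fun _ _ => rfl,
    translate_congr (fun n hn => h n (.inr (.inr hn))) fun _ _ => rfl]

theorem classes_relabel_eq {e : ℕ → ℕ} (he : StrictMono e) {p q : ReductionProblem α}
    (h : p.classes = q.classes) : (p.relabel e).classes = (q.relabel e).classes := by
  simp only [classes, Prod.mk.injEq] at h ⊢
  exact ⟨congrArg e h.1, cls_translate_eq he var h.2.1, cls_translate_eq he var h.2.2⟩

theorem finite_classes_image [Finite α] {s : Set ℕ} (hs : s.Finite) (d : ℕ) :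
    (classes '' {p : ReductionProblem α |
      p.φ.depth < d ∧ p.ψ.depth < d ∧ p.labels ⊆ s}).Finite := by
  refine (hs.prod ((finite_cls_image (α := α) hs d).prod (finite_cls_image hs d))).subset ?_
  rintro _ ⟨p, ⟨hφ, hψ, hp⟩, rfl⟩
  obtain ⟨hm, hmods⟩ := Set.insert_subset_iff.1 hp
  obtain ⟨hφs, hψs⟩ := Set.union_subset_iff.1 hmods
  exact ⟨hm, ⟨p.φ, ⟨hφ, hφs⟩, rfl⟩, ⟨p.ψ, ⟨hψ, hψs⟩, rfl⟩⟩

theorem exists_relabel_eq {d N : ℕ} {p : ReductionProblem α} (hp : p ∈ bounded α d N) :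
    ∃ (f : ℕ ↪o ℕ) (p' : ReductionProblem α), p'.φ.depth < d ∧ p'.ψ.depth < d ∧
      p'.labels ⊆ Set.Iio N ∧ p'.relabel f = p := by
  obtain ⟨hφ, hψ, hN⟩ := hp
  have hfin : p.labels.Finite := (p.φ.mods_finite.union p.ψ.mods_finite).insert _
  obtain ⟨f, hf⟩ := exists_orderEmbedding_nat_subset_image_Iio hfin hN
  obtain ⟨⟨i, hi, hif⟩, hmods⟩ := Set.insert_subset_iff.1 hf
  obtain ⟨hφf, hψf⟩ := Set.union_subset_iff.1 hmods
  obtain ⟨φ', hφd, hφN, hφe⟩ := exists_translate_eq_of_mods_subset_image hφf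
  obtain ⟨ψ', hψd, hψN, hψe⟩ := exists_translate_eq_of_mods_subset_image hψf
  refine ⟨f, ⟨i, φ', ψ'⟩, hφd.trans_lt hφ, hψd.trans_lt hψ,
    Set.insert_subset hi (Set.union_subset hφN hψN), ?_⟩
  rw [relabel, hif, hφe, hψe]

theorem partiallyWellOrderedOn_bounded [Finite α] (d N : ℕ) :
    (bounded α d N).PartiallyWellOrderedOn RelabelsTo := by
  intro p
  choose f p' hφ hψ hlabels hrelabel using fun n => exists_relabel_eq (p n).2
  let C := classes '' {p : ReductionProblem α |
    p.φ.depth < d ∧ p.ψ.depth < d ∧ p.labels ⊆ Set.Iio N}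
  have : Finite C := finite_classes_image (Set.finite_Iio N) d
  let c (n : ℕ) : C := ⟨(p' n).classes, p' n, ⟨hφ n, hψ n, hlabels n⟩, rfl⟩
  obtain ⟨m, n, hmn, hc, e, he, hef⟩ :=
    (Finite.wellQuasiOrdered (Eq (α := C))).prod wellQuasiOrdered_orderEmbedding_nat
      fun n => (c n, (OrderEmbedding.subtype (· ∈ Set.Iio N)).trans (f n))
  have hclasses : (p' m).classes = (p' n).classes := congrArg Subtype.val hc
  have hlabel : ∀ i ∈ (p' m).labels, (e ∘ f m) i = f n i := fun i hi => hef ⟨i, hlabels m hi⟩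
  refine ⟨m, n, hmn, e, he, ?_⟩
  calc ((p m).1.relabel e).classes
      = ((p' m).relabel (e ∘ f m)).classes := by rw [← hrelabel m, relabel_relabel]
    _ = ((p' m).relabel (f n)).classes := by rw [relabel_congr hlabel]
    _ = ((p' n).relabel (f n)).classes := classes_relabel_eq (f n).strictMono hclasses
    _ = (p n).1.classes := by rw [hrelabel n]

theorem solvedBy_iff {p : ReductionProblem α} {k : ℕ} :
    p.SolvedBy k ↔ Provable (imp (Q p.index p.ψ k) (dia p.index p.φ)) := by
  rw [SolvedBy, ← cls_Q, ← cls_dia, Lindenbaum.cls_le]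

theorem solvedBy_mono (p : ReductionProblem α) : Monotone p.SolvedBy :=
  fun _ _ hkl h => (algQ_antitone _ _ hkl).trans h

theorem RelabelsTo.solvedBy_le {p q : ReductionProblem α} (hpq : p.RelabelsTo q) :
    p.SolvedBy ≤ q.SolvedBy := by
  obtain ⟨e, he, hclasses⟩ := hpq
  intro k h
  have hrelabel : (p.relabel e).SolvedBy k := by
    rw [solvedBy_iff] at h ⊢
    simpa only [relabel, Formula.translate, translate_Q, translate_dia] using
      Provable.translate he var h
  simp only [classes, Prod.mk.injEq] at hclasses
  rwa [SolvedBy, hclasses.1, hclasses.2.1, hclasses.2.2] at hrelabel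

theorem exists_uniform_solvedBy (α : Type u) [Finite α] (d N : ℕ) :
    ∃ K, ∀ p ∈ bounded α d N,
      Provable (imp (dia (p.index + 1) p.ψ) (dia p.index p.φ)) → p.SolvedBy K := by
  obtain ⟨K, hK⟩ := exists_uniform_of_partiallyWellOrderedOn
    (s := bounded α d N ∩ {p | Provable (imp (dia (p.index + 1) p.ψ) (dia p.index p.φ))})
    ((partiallyWellOrderedOn_bounded d N).mono Set.inter_subset_left) solvedBy_mono
    (fun _ _ => RelabelsTo.solvedBy_le)
    (fun _ hp => (isFreeOn_gen α).exists_algQ_le_dia (Lindenbaum.cls_le.2 hp.2))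
  exact ⟨K, fun p hp hprov => hK p ⟨hp, hprov⟩⟩

end ReductionProblem

section Uniform

open Formula

theorem exists_uniform_reduction_bound : ∃ K : ℕ → ℕ → ℕ → ℕ,
    ∀ (α : Type u) (m : ℕ) (φ ψ : Formula α),
      Provable (.imp (.dia (m + 1) ψ) (.dia m φ)) →
      Provable (.imp
        (.Q m ψ (K (max φ.depth ψ.depth) (φ.vars ∪ ψ.vars).ncard (φ.mods ∪ ψ.mods).ncard))
        (.dia m φ)) := by
  choose K hK using fun d v s =>
    ReductionProblem.exists_uniform_solvedBy (Fin v) (d + 1) (s + 1)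
  refine ⟨K, fun α m φ ψ h => ?_⟩
  obtain ⟨σ, τ, hdepth, hmods, hτσ⟩ :=
    exists_substitution_fin_ncard (φ.vars_finite.union ψ.vars_finite)
  have hφ : (φ.translate id σ).translate id τ = φ :=
    translate_translate_eq_self (fun _ _ => rfl) fun a ha => hτσ a (.inl ha)
  have hψ : (ψ.translate id σ).translate id τ = ψ :=
    translate_translate_eq_self (fun _ _ => rfl) fun a ha => hτσ a (.inr ha)
  let p : ReductionProblem (Fin (φ.vars ∪ ψ.vars).ncard) :=
    ⟨m, φ.translate id σ, ψ.translate id σ⟩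
  have hp : p ∈ ReductionProblem.bounded _ (max φ.depth ψ.depth + 1)
      ((φ.mods ∪ ψ.mods).ncard + 1) := by
    refine ⟨?_, ?_, ?_⟩
    · simp only [p, depth_translate id hdepth]; lia
    · simp only [p, depth_translate id hdepth]; lia
    · simp only [ReductionProblem.labels, p, mods_translate id hmods, Set.image_id]
      exact Set.ncard_insert_le _ _
  have hσ := Provable.translate strictMono_id σ h
  rw [Formula.translate, translate_dia, translate_dia] at hσ
  have hτ := Provable.translate strictMono_id τ (ReductionProblem.solvedBy_iff.1 (hK _ _ _ p hp hσ))
  rwa [Formula.translate, translate_Q, translate_dia, hφ, hψ] at hτ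

end Uniform

end GLP

theorem mainTheorem1 :
    -- The Lindenbaum algebra of GLP is the free GLP-algebra.
    (∀ α : Type u, GLP.IsFreeOn.{u, u, w} (GLP.gen (α := α))) ∧
    -- Its reduction properties, and those of every other free GLP-algebra.
    (∀ (α : Type u) (n : ℕ), GLP.ReductionProperty (GLP.Lindenbaum α) n) ∧
    (∀ (α M : Type u) [GLP.GLPAlgebra M] (g : α → M), GLP.IsFreeOn.{u, u, u} g →
      ∀ n : ℕ, GLP.ReductionProperty M n) ∧
    -- The uniform version for formulas.
    (∃ K : ℕ → ℕ → ℕ → ℕ, ∀ (α : Type u) (m : ℕ) (φ ψ : GLP.Formula α),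
      GLP.Provable (.imp (.dia (m + 1) ψ) (.dia m φ)) →
      GLP.Provable (.imp
        (.Q m ψ (K (max φ.depth ψ.depth) (φ.vars ∪ ψ.vars).ncard (φ.mods ∪ ψ.mods).ncard))
        (.dia m φ))) :=
  ⟨GLP.isFreeOn_gen, fun α n => (GLP.isFreeOn_gen α).reductionProperty n,
    fun _ _ _ _ hg n => hg.reductionProperty n, GLP.exists_uniform_reduction_bound⟩
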